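/- **Theorem A.** Let $M$ be a von Neumann algebra with a faithful normal tracial state $\tau$ and let $L^1(M,\tau)$ be the completion of $M$ in the norm $\|a\|_1=\tau(|a|)$, identified with the predual of $M$ through $x\mapsto\tau(x\,\cdot\,)$; assume that $L^1(M,\tau)$ is separable. Write $x\ge 0$ if $\tau(xa)\ge 0$ for all $a\in M$ with $a\geq 0$, write $x\le y$ if $y-x\ge 0$, and let $S=\{x\in L^1(M,\tau): x\ge 0,\ \tau(x)=1\}$ be the set of normal states. For $x,y\in S$ put $$m(x,y)=\max\{t\in\mathbb R: ty\le x\},\qquad d(x,y)=\frac{1-m(x,y)m(y,x)}{1+m(x,y)m(y,x)}.$$ A linear map $g$ on $L^1(M,\tau)$ is *positive* if $g(x)\ge 0$ whenever $x\ge 0$, and a positive $g$ is *faithful* if $x\ge0$ and $g(x)=0$ imply $x=0$. For a faithful positive linear $g$ and $x\in S$ put $g\cdot x=\tau(g(x))^{-1}g(x)\in S$, and call $g$ a *strict Hennion contraction* if $$c(g)=\sup_{x,y\in S,\ x\ne y}\frac{d(g\cdot x,g\cdot y)}{d(x,y)}<1$$ (where the supremum of the empty set is $0$). Let $(\Omega,\mathcal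 F,\mathbb P)$ be a probability space, and let $T$ be an ergodic automorphism of it (a bijection such that $T$ and $T^{-1}$ are measurable and measure preserving). For each $\omega\in\Omega$ let $\gamma_\omega$ be a map $L^1(M,\tau)\to L^1(M,\tau)$ such that $\omega\mapsto\gamma_\omega(x)$ is strongly measurable (an almost sure limit of simple functions) for every $x$, and such that for almost every $\omega$ the map $\gamma_\omega$ is linear, bounded, positive and faithful. For integers $n\ge m$ put $$\Gamma_{n,m}(\omega)=\gamma_{T^n\omega}\circ\gamma_{T^{n-1}\omega}\circ\cdots\circ\gamma_{T^m\omega}.$$ Suppose that $$\mathbb P\big[\exists\, n,m\in\mathbb Z:\ n\ge m\text{ and }\Gamma_{n,m}\text{ is a strict Hennion contraction}\big]>0 .$$ Then there are strongly measurable maps $X_n\colon\Omega\to S$, $n\in\mathbb Z$, such that, almost surely, for all $n\in\mathbb Z$, $$\gamma_{T^{n+1}\omega}\cdot X_n(\omega)=X_{n+1}(\omega),\qquad X_n(T^{\pm1}\omega)=X_{n\pm1}(\omega),$$ and such that, for every $x\in S$, almost surely, $$\lim_{m\to-\infty}\|\Gamma_{n,m}\cdot x-X_n\|_1=0\qquad\text{for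 all } n\in\mathbb Z .$$ -/

import Mathlib

open MeasureTheory Filter Topology
open scoped ComplexOrder

namespace ErgodicQuantum

/-! ### Tracial von Neumann algebras and the space `L¹(M, τ)` -/

section Tracial

variable {M : Type*} [CStarAlgebra M] [PartialOrder M] [StarOrderedRing M]

/-- `τ` is a faithful normal tracial state on `M`. Normality is preservation of the least upper
bounds of nonempty upward directed families of positive elements. -/
structure IsFaithfulNormalTrace (τ : StrongDual ℂ M) : Prop where
  map_one : τ 1 = 1
  nonneg : ∀ a : M, 0 ≤ a → 0 ≤ τ a
  trace : ∀ a b : M, τ (a * b) = τ (b * a)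
  faithful : ∀ a : M, 0 ≤ a → τ a = 0 → a = 0
  normal : ∀ D : Set M, D.Nonempty → DirectedOn (· ≤ ·) D → (∀ a ∈ D, 0 ≤ a) →
    ∀ s : M, IsLUB D s → IsLUB ((fun a => (τ a).re) '' D) (τ s).re

/-- The linear map sending `a : M` to the functional `b ↦ τ (a * b)`. -/
noncomputable def traceFunctional (τ : StrongDual ℂ M) : M →ₗ[ℂ] StrongDual ℂ M where
  toFun a := τ.comp (ContinuousLinearMap.mul ℂ M a)
  map_add' a b := by ext c; simp
  map_smul' r a := by ext c; simp

/-- `L¹(M, τ)`, as the norm closure of `{τ(a ·) : a ∈ M}` in the Banach dual of `M`, i.e. as the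
predual of `M`. The dual norm of `τ(a ·)` is `‖a‖₁ = τ(|a|)` (`norm_traceFunctional` below), so
this is the completion of `M` for `‖·‖₁`; an element `x` is identified with the functional
`a ↦ τ(x a)`. -/
noncomputable abbrev L1 (τ : StrongDual ℂ M) : Submodule ℂ (StrongDual ℂ M) :=
  (LinearMap.range (traceFunctional τ)).topologicalClosure

/-- Cauchy–Schwarz for a positive functional. -/
lemma norm_star_mul_sq_le {τ : StrongDual ℂ M} (hτ : ∀ a : M, 0 ≤ a → 0 ≤ τ a) (x y : M) :
    ‖τ (star x * y)‖ ≤ √(τ (star x * x)).re * √(τ (star y * y)).re :=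
  let f : M →ₚ[ℂ] ℂ := PositiveLinearMap.mk₀ τ.toLinearMap hτ
  norm_inner_le_norm (𝕜 := ℂ) (f.toPreGNS x) (f.toPreGNS y)

/-- Approximate polar decomposition `a = u (|a| + ε)`, with `h = |a|`. -/
lemma exists_approx_polar {a h : M} (hp : 0 ≤ h) (hh2 : h * h = star a * a) (ε : ℝ) (hε : 0 < ε) :
    ∃ u : M, ‖u‖ ≤ 1 ∧ u * (h + algebraMap ℝ M ε) = a ∧
      h - algebraMap ℝ M ε ≤ star u * a := by
  have hspec : ∀ t ∈ spectrum ℝ h, 0 ≤ t := fun t ht => spectrum_nonneg_of_nonneg hp ht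
  have hsa : IsSelfAdjoint h := hp.isSelfAdjoint
  have hid : cfc (fun t : ℝ => t) h = h := cfc_id' ℝ h
  have hne : ∀ t ∈ spectrum ℝ h, t + ε ≠ 0 := fun t ht => by have := hspec t ht; positivity
  have hc : ContinuousOn (fun t : ℝ => (t + ε)⁻¹) (spectrum ℝ h) :=
    ContinuousOn.inv₀ (by fun_prop) hne
  obtain ⟨v, hv⟩ : ∃ v : M, v = cfc (fun t : ℝ => (t + ε)⁻¹) h := ⟨_, rfl⟩
  have hvsa : star v = v := hv ▸ (cfc_predicate (R := ℝ) (fun t : ℝ => (t + ε)⁻¹) h :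
    IsSelfAdjoint (cfc (fun t : ℝ => (t + ε)⁻¹) h))
  have hk : h + algebraMap ℝ M ε = cfc (fun t : ℝ => t + ε) h := by
    rw [cfc_add_const ε (fun t : ℝ => t) h, hid]
  have hv1 : v * (h + algebraMap ℝ M ε) = 1 := by
    rw [hk, hv, ← cfc_mul (fun t : ℝ => (t + ε)⁻¹) (fun t : ℝ => t + ε) h hc (by fun_prop),
      ← cfc_one ℝ h]
    exact cfc_congr fun t ht => inv_mul_cancel₀ (hne t ht)
  have hvh : v * (h * h) = cfc (fun t : ℝ => (t + ε)⁻¹ * (t * t)) h := by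
    have hhh : h * h = cfc (fun t : ℝ => t * t) h := by
      rw [cfc_mul (fun t : ℝ => t) (fun t : ℝ => t) h (by fun_prop) (by fun_prop), hid]
    rw [hhh, hv, ← cfc_mul (fun t : ℝ => (t + ε)⁻¹) (fun t : ℝ => t * t) h hc (by fun_prop)]
  have hua : star (a * v) * a = v * (h * h) := by
    rw [star_mul, hvsa, mul_assoc, hh2]
  refine ⟨a * v, ?_, ?_, ?_⟩
  · have h1 : star (a * v) * (a * v) = cfc (fun t : ℝ => (t + ε)⁻¹ * (t * t) * (t + ε)⁻¹) h := by
      rw [← mul_assoc, hua, hvh, hv, ← cfc_mul (fun t : ℝ => (t + ε)⁻¹ * (t * t))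
        (fun t : ℝ => (t + ε)⁻¹) h (hc.mul (by fun_prop)) hc]
    have h2 : ‖star (a * v) * (a * v)‖ ≤ 1 := by
      rw [h1]
      refine norm_cfc_le zero_le_one fun t ht => ?_
      have ht0 := hspec t ht
      have : (t + ε)⁻¹ * (t * t) * (t + ε)⁻¹ = (t / (t + ε)) ^ 2 := by
        field_simp
      rw [this, Real.norm_of_nonneg (by positivity)]
      exact pow_le_one₀ (by positivity) ((div_le_one (by positivity)).2 (by linarith))
    rw [CStarRing.norm_star_mul_self] at h2
    nlinarith [norm_nonneg (a * v)]
  · rw [mul_assoc, hv1, mul_one]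
  · rw [hua, hvh]
    have : h - algebraMap ℝ M ε = cfc (fun t : ℝ => t - ε) h := by
      rw [cfc_sub (fun t : ℝ => t) (fun _ : ℝ => ε) h (by fun_prop) (by fun_prop), hid,
        cfc_const ε h]
    rw [this]
    refine cfc_mono (fun t ht => ?_) (by fun_prop) (hc.mul (by fun_prop))
    have ht0 := hspec t ht
    have hpos : 0 < t + ε := by positivity
    rw [inv_mul_eq_div, le_div_iff₀ hpos]
    nlinarith [sq_nonneg ε]

/-- The dual norm of the functional `τ(a ·)` is `‖a‖₁ = τ(|a|)`. -/
lemma norm_traceFunctional {τ : StrongDual ℂ M} (hτ : IsFaithfulNormalTrace τ) (a : M) :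
    ‖traceFunctional τ a‖ = (τ (CFC.abs a)).re := by
  have mono : ∀ {x y : M}, x ≤ y → (τ x).re ≤ (τ y).re := fun {x y} hxy => by
    have := (Complex.le_def.1 (hτ.nonneg _ (sub_nonneg.2 hxy))).1
    simpa using this
  have hp : 0 ≤ CFC.abs a := CFC.abs_nonneg a
  have hh2 : CFC.abs a * CFC.abs a = star a * a := CFC.abs_mul_abs a
  generalize CFC.abs a = h at hp hh2 ⊢
  have key := fun ε hε => exists_approx_polar hp hh2 ε hε
  have hτε : ∀ ε : ℝ, (τ (algebraMap ℝ M ε)).re = ε := fun ε => by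
    have : algebraMap ℝ M ε = (ε : ℂ) • (1 : M) := by
      rw [Algebra.algebraMap_eq_smul_one]; simp
    rw [this, map_smul, hτ.map_one]; simp
  have hτh : 0 ≤ (τ h).re := (Complex.le_def.1 (hτ.nonneg h hp)).1
  apply le_antisymm
  · refine ContinuousLinearMap.opNorm_le_bound _ hτh fun b => ?_
    refine le_of_forall_pos_le_add fun δ hδ => ?_
    obtain ⟨ε, hε, hεδ⟩ : ∃ ε : ℝ, 0 < ε ∧ ε * ‖b‖ ≤ δ :=
      ⟨δ / (‖b‖ + 1), by positivity, by
        rw [div_mul_eq_mul_div, div_le_iff₀ (by positivity)]; nlinarith [norm_nonneg b]⟩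
    obtain ⟨u, hu, hua, -⟩ := key ε hε
    obtain ⟨k, hk⟩ : ∃ k : M, k = h + algebraMap ℝ M ε := ⟨_, rfl⟩
    rw [← hk] at hua
    have hkp : 0 ≤ k := hk ▸ add_nonneg hp (algebraMap_nonneg M hε.le)
    obtain ⟨s, hss, hssa⟩ : ∃ s : M, s * s = k ∧ star s = s :=
      ⟨CFC.sqrt k, CFC.sqrt_mul_sqrt_self k, (CFC.sqrt_nonneg k).isSelfAdjoint⟩
    have e1 : traceFunctional τ a b = τ (star s * (b * u * s)) := by
      calc traceFunctional τ a b = τ (a * b) := rfl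
        _ = τ (b * u * s * s) := by
          rw [hτ.trace, ← hua, ← hss]; simp only [mul_assoc]
        _ = τ (star s * (b * u * s)) := by rw [hτ.trace, hssa]
    have e2 : star (b * u * s) * (b * u * s) ≤ ‖b‖ ^ 2 • k := by
      have : star (b * u * s) * (b * u * s) = star s * (star (b * u) * (b * u)) * s := by
        rw [star_mul]; simp only [mul_assoc]
      rw [this]
      have h3 : star (b * u) * (b * u) ≤ algebraMap ℝ M (‖b‖ ^ 2) := by
        refine (IsSelfAdjoint.le_algebraMap_norm_self (IsSelfAdjoint.star_mul_self (b * u))).trans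
          (algebraMap_mono M ?_)
        rw [CStarRing.norm_star_mul_self, ← sq]
        have : ‖b * u‖ ≤ ‖b‖ := (norm_mul_le _ _).trans
          (mul_le_of_le_one_right (norm_nonneg b) hu)
        gcongr
      refine (star_left_conjugate_le_conjugate h3 s).trans (le_of_eq ?_)
      rw [Algebra.algebraMap_eq_smul_one, mul_smul_comm, mul_one, smul_mul_assoc, hssa, hss]
    have hτk : (τ k).re = (τ h).re + ε := by rw [hk, map_add, Complex.add_re, hτε]
    have e3 : (τ (star (b * u * s) * (b * u * s))).re ≤ ‖b‖ ^ 2 * (τ k).re := by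
      refine (mono e2).trans (le_of_eq ?_)
      have : ‖b‖ ^ 2 • k = ((‖b‖ ^ 2 : ℝ) : ℂ) • k := (Complex.coe_smul _ _).symm
      rw [this, map_smul, smul_eq_mul, Complex.re_ofReal_mul]
    have hk0 : 0 ≤ (τ k).re := by rw [hτk]; positivity
    calc ‖traceFunctional τ a b‖ ≤ √(τ (star s * s)).re *
          √(τ (star (b * u * s) * (b * u * s))).re := by
          rw [e1]; exact norm_star_mul_sq_le hτ.nonneg _ _
      _ ≤ √(τ k).re * √(‖b‖ ^ 2 * (τ k).re) := by
          rw [hssa, hss]; gcongr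
      _ = ‖b‖ * (τ k).re := by
          rw [Real.sqrt_mul (by positivity), Real.sqrt_sq (norm_nonneg b)]
          nlinarith [Real.mul_self_sqrt hk0]
      _ ≤ (τ h).re * ‖b‖ + δ := by rw [hτk]; nlinarith
  · refine le_of_forall_pos_le_add fun ε hε => ?_
    obtain ⟨u, hu, -, hua⟩ := key ε hε
    have h1 : (τ h).re - ε ≤ (τ (star u * a)).re := by
      have := mono hua
      rwa [map_sub, Complex.sub_re, hτε] at this
    have h2 : (τ (star u * a)).re ≤ ‖traceFunctional τ a‖ := by
      calc (τ (star u * a)).re = (traceFunctional τ a (star u)).re := by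
            rw [hτ.trace]; rfl
        _ ≤ ‖traceFunctional τ a (star u)‖ := Complex.re_le_norm _
        _ ≤ ‖traceFunctional τ a‖ * ‖star u‖ := ContinuousLinearMap.le_opNorm _ _
        _ ≤ ‖traceFunctional τ a‖ := by
            rw [norm_star]; exact mul_le_of_le_one_right (norm_nonneg _) hu
    linarith

variable {τ : StrongDual ℂ M}

/-- `x ≥ 0` in `L¹(M, τ)`: `τ(x a) ≥ 0` for all `a ≥ 0` in `M`. -/
def Pos (x : L1 τ) : Prop := ∀ a : M, 0 ≤ a → 0 ≤ (x : StrongDual ℂ M) a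

/-- The extension of the trace to `L¹(M, τ)`, `x ↦ τ(x) = τ(x 1)`. -/
noncomputable def tr (x : L1 τ) : ℂ := (x : StrongDual ℂ M) 1

variable (τ) in
/-- The normal state space `S = {x ∈ L¹(M, τ)₊ : τ(x) = 1}`. -/
def normalStates : Set (L1 τ) := {x | Pos x ∧ tr x = 1}

/-! ### Hennion's metric, projective actions and contraction constants -/

/-- `m(x, y) = max {t ∈ ℝ : t y ≤ x}`. -/
noncomputable def mQuantity (x y : L1 τ) : ℝ := sSup {t : ℝ | Pos (x - (t : ℂ) • y)}

/-- Hennion's metric on the normal states. -/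
noncomputable def hennionDist (x y : L1 τ) : ℝ :=
  (1 - mQuantity x y * mQuantity y x) / (1 + mQuantity x y * mQuantity y x)

/-- The projective action `γ · x = τ(γ(x))⁻¹ γ(x)`. -/
noncomputable def projAction (g : L1 τ → L1 τ) (x : L1 τ) : L1 τ := (tr (g x))⁻¹ • g x

/-- Positivity of a map on `L¹(M, τ)`. -/
def IsPositiveMap (g : L1 τ → L1 τ) : Prop := ∀ x, Pos x → Pos (g x)

/-- Faithfulness of a (positive linear) map on `L¹(M, τ)`: it kills no nonzero positive element. -/
def IsFaithfulMap (g : L1 τ → L1 τ) : Prop := ∀ x, Pos x → g x = 0 → x = 0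

/-- The Hennion contraction constant `c(γ)`. -/
noncomputable def contractionConst (g : L1 τ → L1 τ) : ℝ :=
  sSup {r : ℝ | ∃ x ∈ normalStates τ, ∃ y ∈ normalStates τ, x ≠ y ∧
    r = hennionDist (projAction g x) (projAction g y) / hennionDist x y}

/-- `γ` is a strict Hennion contraction: a faithful positive linear map with `c(γ) < 1`. -/
structure IsStrictHennionContraction (g : L1 τ → L1 τ) : Prop where
  linear : IsLinearMap ℂ g
  positive : IsPositiveMap g
  faithful : IsFaithfulMap g
  lt_one : contractionConst g < 1

/-! ### Random linear operators and quantum processes -/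

variable {Ω : Type*} [MeasurableSpace Ω]

/-- `γ` is a random linear operator on `L¹(M, τ)`: each `ω ↦ γ_ω(x)` is strongly measurable (an
almost sure limit of simple functions), and `γ` is almost surely linear on each fixed
linear combination. -/
structure IsRandomLinearOperator (P : Measure Ω) (γ : Ω → L1 τ → L1 τ) : Prop where
  measurable : ∀ x : L1 τ, AEStronglyMeasurable (fun ω => γ ω x) P
  linear : ∀ (α β : ℂ) (x y : L1 τ), ∀ᵐ ω ∂P, γ ω (α • x + β • y) = α • γ ω x + β • γ ω y

/-- `γ` is a bounded positive faithful random linear operator: almost surely `γ_ω` is a bounded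
positive faithful linear map. -/
structure IsBddPosFaithfulRLO (P : Measure Ω) (γ : Ω → L1 τ → L1 τ) : Prop
    extends IsRandomLinearOperator P γ where
  bounded : ∀ᵐ ω ∂P, IsBoundedLinearMap ℂ (γ ω)
  positive : ∀ᵐ ω ∂P, IsPositiveMap (γ ω)
  faithful : ∀ᵐ ω ∂P, IsFaithfulMap (γ ω)

/-- The integer power `T ^ n` of an invertible transformation, applied to `ω`. -/
def iter (T : Ω ≃ᵐ Ω) (n : ℤ) (ω : Ω) : Ω := ((T.toEquiv : Equiv.Perm Ω) ^ n) ω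

/-- The composition `γ_{T^{m+k} ω} ∘ ⋯ ∘ γ_{T^m ω}`. -/
def processAux (T : Ω ≃ᵐ Ω) (γ : Ω → L1 τ → L1 τ) (m : ℤ) (ω : Ω) : ℕ → L1 τ → L1 τ
  | 0 => γ (iter T m ω)
  | k + 1 => γ (iter T (m + (k + 1 : ℕ)) ω) ∘ processAux T γ m ω k

/-- The quantum process `Γ_{n,m}(ω) = γ_{T^n ω} ∘ ⋯ ∘ γ_{T^m ω}`, for integers `n ≥ m` (it is used
only for such `n`, `m`). -/
def process (T : Ω ≃ᵐ Ω) (γ : Ω → L1 τ → L1 τ) (n m : ℤ) (ω : Ω) : L1 τ → L1 τ :=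
  processAux T γ m ω (n - m).toNat

end Tracial

end ErgodicQuantum

namespace ErgodicQuantum

/-! ### Normed spaces with a closed cone and a trace -/

/-! The mechanism is Birkhoff–Hopf contraction, run on the relative oscillation of cone elements
(`Osc`) rather than on Hennion's metric. Write τ for the trace.

If c(g) < 1, then g·x ≥ δ (g·y) for all states x, y with a single δ > 0
(`exists_minorizing_of_contractionConst_lt_one`). Such a map brings any two states within a finite
relative oscillation (`Minorizing.oscDiam`) and multiplies existing oscillation by 1 - δ
(`Minorizing.osc_map`), while every faithful positive map preserves oscillation bounds (`Osc.map`).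
Because ‖x‖ ≤ τ(x) on the cone, relative oscillation controls the norm distance of normalized
elements (`Osc.norm_sub_le`).

Ergodicity of the inverse of T, with Poincaré recurrence, turns one minorizing block of positive
probability into infinitely many such blocks in the past of almost every orbit, all with the same δ
(`exists_ae_recurrent_minorizing`). The images of the state space under longer and longer backward
products therefore shrink geometrically to one point, which is X_n
(`exists_tendsto_projAction_prod`). Measurability passes to this limit; uniqueness of limits gives
stationarity, and continuity of the projective action gives the evolution equation. -/

/-- A closed convex cone in a complex normed space, together with a bounded functional `trace` which
is real on the cone and dominates the norm there. -/
structure TracedCone (E : Type*) [NormedAddCommGroup E] [NormedSpace ℂ E] where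
  carrier : Set E
  trace : E →L[ℂ] ℂ
  isClosed : IsClosed carrier
  zero_mem : 0 ∈ carrier
  add_mem : ∀ x ∈ carrier, ∀ y ∈ carrier, x + y ∈ carrier
  smul_mem : ∀ x ∈ carrier, ∀ t : ℝ, 0 ≤ t → (t : ℂ) • x ∈ carrier
  trace_im : ∀ x ∈ carrier, (trace x).im = 0
  norm_le_trace : ∀ x ∈ carrier, ‖x‖ ≤ (trace x).re

namespace TracedCone

variable {E : Type*} [NormedAddCommGroup E] [NormedSpace ℂ E] {K : TracedCone E}

/-- Membership in the cone. -/
def Pos (K : TracedCone E) (x : E) : Prop := x ∈ K.carrier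

/-- The real part of the trace. -/
noncomputable def retr (K : TracedCone E) (x : E) : ℝ := (K.trace x).re

/-- The elements of the cone of trace one. -/
def states (K : TracedCone E) : Set E := {x | K.Pos x ∧ K.trace x = 1}

/-- The projective action `g · x = τ(g(x))⁻¹ g(x)`. -/
noncomputable def projAction (K : TracedCone E) (g : E → E) (x : E) : E := (K.trace (g x))⁻¹ • g x

/-- The map `g` preserves the cone. -/
def IsPositiveMap (K : TracedCone E) (g : E → E) : Prop := ∀ x, K.Pos x → K.Pos (g x)

/-- The map `g` kills no nonzero element of the cone. -/
def IsFaithfulMap (K : TracedCone E) (g : E → E) : Prop := ∀ x, K.Pos x → g x = 0 → x = 0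

/-- `m(x, y) = max {t ∈ ℝ : t y ≤ x}`. -/
noncomputable def mQuantity (K : TracedCone E) (x y : E) : ℝ :=
  sSup {t : ℝ | K.Pos (x - (t : ℂ) • y)}

/-- Hennion's metric on the states. -/
noncomputable def hennionDist (K : TracedCone E) (x y : E) : ℝ :=
  (1 - K.mQuantity x y * K.mQuantity y x) / (1 + K.mQuantity x y * K.mQuantity y x)

/-- The Hennion contraction constant. -/
noncomputable def contractionConst (K : TracedCone E) (g : E → E) : ℝ :=
  sSup {r : ℝ | ∃ x ∈ K.states, ∃ y ∈ K.states, x ≠ y ∧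
    r = K.hennionDist (K.projAction g x) (K.projAction g y) / K.hennionDist x y}

lemma retr_add (x y : E) : K.retr (x + y) = K.retr x + K.retr y := by simp [retr]

lemma retr_sub (x y : E) : K.retr (x - y) = K.retr x - K.retr y := by simp [retr]

lemma retr_smul (t : ℝ) (x : E) : K.retr ((t : ℂ) • x) = t * K.retr x := by simp [retr]

lemma continuous_retr : Continuous K.retr := Complex.continuous_re.comp K.trace.continuous

lemma Pos.zero : K.Pos 0 := K.zero_mem

lemma Pos.add {x y : E} (hx : K.Pos x) (hy : K.Pos y) : K.Pos (x + y) := K.add_mem x hx y hy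

lemma Pos.smul {x : E} (hx : K.Pos x) {t : ℝ} (ht : 0 ≤ t) : K.Pos ((t : ℂ) • x) :=
  K.smul_mem x hx t ht

lemma isClosed_pos : IsClosed {x : E | K.Pos x} := K.isClosed

lemma Pos.trace_eq {x : E} (hx : K.Pos x) : K.trace x = (K.retr x : ℂ) :=
  Complex.ext (by simp [retr]) (by simpa using K.trace_im x hx)

lemma Pos.norm_le {x : E} (hx : K.Pos x) : ‖x‖ ≤ K.retr x := K.norm_le_trace x hx

lemma Pos.retr_nonneg {x : E} (hx : K.Pos x) : 0 ≤ K.retr x := (norm_nonneg x).trans hx.norm_le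

lemma Pos.retr_pos {x : E} (hx : K.Pos x) (h0 : x ≠ 0) : 0 < K.retr x :=
  (norm_pos_iff.2 h0).trans_le hx.norm_le

lemma retr_eq_one {x : E} (hx : x ∈ K.states) : K.retr x = 1 := by simp [retr, hx.2]

lemma ne_zero_of_retr_pos {x : E} (hx : 0 < K.retr x) : x ≠ 0 := by
  rintro rfl
  simp [retr] at hx

lemma isClosed_states : IsClosed K.states :=
  isClosed_pos.inter (isClosed_eq K.trace.continuous continuous_const)

lemma inv_trace_smul {x : E} (hx : K.Pos x) :
    (K.trace x)⁻¹ • x = (((K.retr x)⁻¹ : ℝ) : ℂ) • x := by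
  rw [hx.trace_eq, Complex.ofReal_inv]

lemma inv_trace_smul_mem {x : E} (hx : K.Pos x) (h0 : x ≠ 0) :
    (K.trace x)⁻¹ • x ∈ K.states := by
  refine ⟨?_, ?_⟩
  · rw [inv_trace_smul hx]
    exact hx.smul (inv_nonneg.2 hx.retr_nonneg)
  · have : K.trace x ≠ 0 := by
      rw [hx.trace_eq]
      exact_mod_cast (hx.retr_pos h0).ne'
    rw [map_smul, smul_eq_mul, inv_mul_cancel₀ this]

/-! ### Relative oscillation -/

/-- `a y ≤ x ≤ b y` for some `a > 0` and `b` with `b - a ≤ ε a`. -/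
def Osc (K : TracedCone E) (ε : ℝ) (x y : E) : Prop :=
  K.Pos y ∧ 0 < K.retr y ∧ ∃ a b : ℝ, 0 < a ∧ K.Pos (x - (a : ℂ) • y) ∧ K.Pos ((b : ℂ) • y - x) ∧
    b - a ≤ ε * a

/-- The difference z of the normalized elements has trace 0 and becomes positive after adding a
small multiple w of y. Hence ‖z‖ ≤ ‖z + w‖ + ‖w‖ ≤ 2 τ(w), and τ(w) ≤ ε because τ(x) ≥ a τ(y). -/
lemma Osc.norm_sub_le {ε : ℝ} {x y : E} (h : K.Osc ε x y) :
    ‖(K.trace x)⁻¹ • x - (K.trace y)⁻¹ • y‖ ≤ 2 * ε := by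
  obtain ⟨hy, hy0, a, b, ha, h1, h2, h3⟩ := h
  have hx : K.Pos x := by
    simpa using h1.add (hy.smul ha.le)
  have e1 : a * K.retr y ≤ K.retr x := by
    have := h1.retr_nonneg
    rw [retr_sub, retr_smul] at this
    linarith
  have e2 : K.retr x ≤ b * K.retr y := by
    have := h2.retr_nonneg
    rw [retr_sub, retr_smul] at this
    linarith
  have hx0 : 0 < K.retr x := lt_of_lt_of_le (by positivity) e1
  have hxr : a ≤ K.retr x / K.retr y := by rwa [le_div_iff₀ hy0]
  have hxr' : K.retr x / K.retr y ≤ b := by rwa [div_le_iff₀ hy0]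
  rw [inv_trace_smul hx, inv_trace_smul hy]
  generalize hz : (((K.retr x)⁻¹ : ℝ) : ℂ) • x - (((K.retr y)⁻¹ : ℝ) : ℂ) • y = z
  have hw : K.Pos ((((K.retr x)⁻¹ * (b - a) : ℝ) : ℂ) • y) :=
    hy.smul (mul_nonneg (by positivity) (by linarith))
  generalize hwd : (((K.retr x)⁻¹ * (b - a) : ℝ) : ℂ) • y = w at hw
  have hzt : K.retr z = 0 := by
    rw [← hz, retr_sub, retr_smul, retr_smul, inv_mul_cancel₀ hx0.ne', inv_mul_cancel₀ hy0.ne',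
      sub_self]
  have hwt : K.retr w ≤ ε := by
    rw [← hwd, retr_smul, mul_assoc, inv_mul_le_iff₀ hx0]
    have hε : 0 ≤ ε := by
      by_contra hcon
      nlinarith
    nlinarith
  -- τ(x) (z + w) = (x - a y) + (b - τ(x)/τ(y)) y, and both summands lie in the cone.
  have hzw : K.Pos (z + w) := by
    convert (h1.add (hy.smul (sub_nonneg.2 hxr'))).smul (inv_nonneg.2 hx0.le) using 1
    rw [← hz, ← hwd]
    have hxc : (K.retr x : ℂ) ≠ 0 := by exact_mod_cast hx0.ne'
    have hyc : (K.retr y : ℂ) ≠ 0 := by exact_mod_cast hy0.ne'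
    push_cast
    match_scalars
    · ring
    · field_simp
      ring
  calc ‖z‖ = ‖(z + w) - w‖ := by rw [add_sub_cancel_right]
    _ ≤ ‖z + w‖ + ‖w‖ := _root_.norm_sub_le _ _
    _ ≤ K.retr (z + w) + K.retr w := add_le_add hzw.norm_le hw.norm_le
    _ ≤ 2 * ε := by rw [retr_add, hzt]; linarith

/-! ### Faithful positive operators and minorization -/

/-- Bounded linear maps that are positive and faithful. -/
structure IsFaithfulPositive (K : TracedCone E) (g : E → E) : Prop where
  bounded : IsBoundedLinearMap ℂ g
  positive : K.IsPositiveMap g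
  faithful : K.IsFaithfulMap g

lemma IsFaithfulPositive.comp {g h : E → E} (hg : K.IsFaithfulPositive g)
    (hh : K.IsFaithfulPositive h) : K.IsFaithfulPositive (g ∘ h) where
  bounded := hg.bounded.comp hh.bounded
  positive := fun x hx => hg.positive _ (hh.positive x hx)
  faithful := fun x hx h0 => hh.faithful x hx (hg.faithful _ (hh.positive x hx) h0)

lemma retr_map_pos {g : E → E} (hp : K.IsPositiveMap g) (hf : K.IsFaithfulMap g) {x : E}
    (hx : K.Pos x) (hx0 : 0 < K.retr x) : 0 < K.retr (g x) :=
  (hp x hx).retr_pos fun h => ne_zero_of_retr_pos hx0 (hf x hx h)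

lemma retr_map_state_pos {g : E → E} (hp : K.IsPositiveMap g) (hf : K.IsFaithfulMap g)
    {x : E} (hx : x ∈ K.states) : 0 < K.retr (g x) :=
  retr_map_pos hp hf hx.1 (by rw [retr_eq_one hx]; exact one_pos)

lemma projAction_mem {g : E → E} (hp : K.IsPositiveMap g) (hf : K.IsFaithfulMap g)
    {x : E} (hx : x ∈ K.states) : K.projAction g x ∈ K.states :=
  inv_trace_smul_mem (hp x hx.1) (ne_zero_of_retr_pos (retr_map_state_pos hp hf hx))

lemma projAction_eq {g : E → E} (hp : K.IsPositiveMap g) {x : E} (hx : K.Pos x) :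
    K.projAction g x = (((K.retr (g x))⁻¹ : ℝ) : ℂ) • g x := inv_trace_smul (hp x hx)

lemma projAction_comp {g h : E → E} (hg : K.IsFaithfulPositive g)
    (hh : K.IsFaithfulPositive h) {x : E} (hx : x ∈ K.states) :
    K.projAction (g ∘ h) x = K.projAction g (K.projAction h x) := by
  have h0 := retr_map_state_pos hh.positive hh.faithful hx
  have h1 := retr_map_pos hg.positive hg.faithful (hh.positive x hx.1) h0
  rw [projAction_eq (hg.comp hh).positive hx.1, projAction_eq hg.positive
    (projAction_mem hh.positive hh.faithful hx).1, projAction_eq hh.positive hx.1,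
    hg.bounded.toIsLinearMap.map_smul, retr_smul, smul_smul, Function.comp_apply]
  congr 1
  rw [← Complex.ofReal_mul]
  congr 1
  field_simp

/-- The minorization `g · x ≥ δ (g · y)` for all normal states `x`, `y`. -/
def Minorizing (K : TracedCone E) (δ : ℝ) (g : E → E) : Prop :=
  ∀ x ∈ K.states, ∀ y ∈ K.states,
    K.Pos ((K.retr (g y) : ℂ) • g x - ((δ * K.retr (g x) : ℝ) : ℂ) • g y)

/-- The inequality is homogeneous in both arguments, so it extends from states to the whole cone;
this allows it to be applied to gaps such as x - a y. -/
lemma Minorizing.cone {δ : ℝ} {g : E → E} (h : K.Minorizing δ g) (hl : IsLinearMap ℂ g)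
    {u v : E} (hu : K.Pos u) (hv : K.Pos v) :
    K.Pos ((K.retr (g v) : ℂ) • g u - ((δ * K.retr (g u) : ℝ) : ℂ) • g v) := by
  have hz : K.retr 0 = 0 := by simp [retr]
  by_cases hu0 : u = 0
  · subst hu0
    rw [hl.map_zero, hz]
    simpa using Pos.zero
  by_cases hv0 : v = 0
  · subst hv0
    rw [hl.map_zero, hz]
    simpa using Pos.zero
  have pu := hu.retr_pos hu0
  have pv := hv.retr_pos hv0
  have key := (h _ (inv_trace_smul_mem hu hu0) _ (inv_trace_smul_mem hv hv0)).smul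
    (mul_pos pu pv).le
  rw [inv_trace_smul hu, inv_trace_smul hv] at key
  convert key using 1
  rw [hl.map_smul, hl.map_smul, retr_smul, retr_smul]
  have hxc : (K.retr u : ℂ) ≠ 0 := by exact_mod_cast pu.ne'
  have hyc : (K.retr v : ℂ) ≠ 0 := by exact_mod_cast pv.ne'
  push_cast
  match_scalars <;> field_simp

lemma Osc.map {ε : ℝ} {x y : E} (h : K.Osc ε x y) {g : E → E}
    (hg : K.IsFaithfulPositive g) : K.Osc ε (g x) (g y) := by
  obtain ⟨hy, hy0, a, b, ha, h1, h2, h3⟩ := h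
  have hl := hg.bounded.toIsLinearMap
  refine ⟨hg.positive y hy, retr_map_pos hg.positive hg.faithful hy hy0, a, b, ha, ?_, ?_, h3⟩
  · have := hg.positive _ h1
    rwa [hl.map_sub, hl.map_smul] at this
  · have := hg.positive _ h2
    rwa [hl.map_sub, hl.map_smul] at this

/-- Compare the two gaps x - a y and b y - x with y. With r = τ(g x)/τ(g y), minorization raises the
lower bound a by δ (r - a) and lowers the upper bound b by δ (b - r), so the width becomes exactly
(1 - δ)(b - a), while the lower bound does not decrease. -/
lemma Minorizing.osc_map {ε δ : ℝ} {x y : E} (h : K.Osc ε x y) {g : E → E}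
    (hg : K.IsFaithfulPositive g) (hδ0 : 0 ≤ δ) (hδ1 : δ ≤ 1) (hgδ : K.Minorizing δ g) :
    K.Osc ((1 - δ) * ε) (g x) (g y) := by
  obtain ⟨hy, hy0, a, b, ha, h1, h2, h3⟩ := h
  have hl := hg.bounded.toIsLinearMap
  have hgy := retr_map_pos hg.positive hg.faithful hy hy0
  have hyc : (K.retr (g y) : ℂ) ≠ 0 := by exact_mod_cast hgy.ne'
  have k1 := (hgδ.cone hl h1 hy).smul (inv_nonneg.2 hgy.le)
  have k2 := (hgδ.cone hl h2 hy).smul (inv_nonneg.2 hgy.le)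
  have n1 := (hg.positive _ h1).retr_nonneg
  have e1 : g (x - (a : ℂ) • y) = g x - (a : ℂ) • g y := by rw [hl.map_sub, hl.map_smul]
  have e2 : g ((b : ℂ) • y - x) = (b : ℂ) • g y - g x := by rw [hl.map_sub, hl.map_smul]
  rw [e1] at k1 n1
  rw [e2] at k2
  have r1 : K.retr (g x - (a : ℂ) • g y) = K.retr (g x) - a * K.retr (g y) := by
    rw [retr_sub, retr_smul]
  have r2 : K.retr ((b : ℂ) • g y - g x) = b * K.retr (g y) - K.retr (g x) := by
    rw [retr_sub, retr_smul]
  rw [r1] at k1 n1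
  rw [r2] at k2
  have q1 : 0 ≤ δ * ((K.retr (g x) - a * K.retr (g y)) / K.retr (g y)) := by positivity
  refine ⟨hg.positive y hy, hgy, a + δ * ((K.retr (g x) - a * K.retr (g y)) / K.retr (g y)),
    b - δ * ((b * K.retr (g y) - K.retr (g x)) / K.retr (g y)), by linarith, ?_, ?_, ?_⟩
  · convert k1 using 1
    push_cast
    match_scalars <;> field_simp
    ring
  · convert k2 using 1
    push_cast
    match_scalars <;> field_simp
  · have e : b - δ * ((b * K.retr (g y) - K.retr (g x)) / K.retr (g y)) -
        (a + δ * ((K.retr (g x) - a * K.retr (g y)) / K.retr (g y))) = (1 - δ) * (b - a) := by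
      field_simp
      ring
    rw [e]
    have h4 : (1 - δ) * (b - a) ≤ (1 - δ) * (ε * a) :=
      mul_le_mul_of_nonneg_left h3 (by linarith)
    by_cases hε : 0 ≤ ε
    · have : 0 ≤ (1 - δ) * ε := mul_nonneg (by linarith) hε
      nlinarith
    -- A negative ε is impossible: positivity forces a ≤ b, against b - a ≤ ε a < 0.
    · have hb : a ≤ b := by
        have hpos := (h1.add h2).retr_nonneg
        rw [show x - (a : ℂ) • y + ((b : ℂ) • y - x) = ((b - a : ℝ) : ℂ) • y by
          push_cast; module, retr_smul] at hpos
        nlinarith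
      nlinarith

/-- All pairs of states have images of relative oscillation at most `ε`. -/
def OscDiam (K : TracedCone E) (ε : ℝ) (g : E → E) : Prop :=
  ∀ x ∈ K.states, ∀ y ∈ K.states, K.Osc ε (g x) (g y)

/-- Minorization used in both directions traps g x between δ r (g y) and δ⁻¹ r (g y), where r = τ(g
x)/τ(g y); the quotient of the two bounds is δ⁻². -/
lemma Minorizing.oscDiam {δ : ℝ} {g : E → E} (hg : K.IsFaithfulPositive g) (hδ0 : 0 < δ)
    (hgδ : K.Minorizing δ g) : K.OscDiam (δ⁻¹ ^ 2) g := by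
  intro x hx y hy
  have px := retr_map_state_pos hg.positive hg.faithful hx
  have py := retr_map_state_pos hg.positive hg.faithful hy
  have hxc : (K.retr (g x) : ℂ) ≠ 0 := by exact_mod_cast px.ne'
  have hyc : (K.retr (g y) : ℂ) ≠ 0 := by exact_mod_cast py.ne'
  have hδc : (δ : ℂ) ≠ 0 := by exact_mod_cast hδ0.ne'
  refine ⟨hg.positive y hy.1, py, δ * (K.retr (g x) / K.retr (g y)), δ⁻¹ * (K.retr (g x) / K.retr (g y)),
    by positivity, ?_, ?_, ?_⟩
  · convert (hgδ x hx y hy).smul (inv_nonneg.2 py.le) using 1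
    push_cast
    match_scalars <;> field_simp
  · convert (hgδ y hy x hx).smul (inv_nonneg.2 (mul_pos hδ0 py).le) using 1
    push_cast
    match_scalars <;> field_simp
  · have : 0 < δ * (K.retr (g x) / K.retr (g y)) := by positivity
    have e : δ⁻¹ ^ 2 * (δ * (K.retr (g x) / K.retr (g y))) = δ⁻¹ * (K.retr (g x) / K.retr (g y)) := by
      field_simp
    linarith

lemma OscDiam.comp_left {ε : ℝ} {g h : E → E} (hh : K.OscDiam ε h)
    (hg : K.IsFaithfulPositive g) : K.OscDiam ε (g ∘ h) :=
  fun x hx y hy => (hh x hx y hy).map hg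

lemma OscDiam.comp_minorizing {ε δ : ℝ} {g h : E → E} (hh : K.OscDiam ε h)
    (hg : K.IsFaithfulPositive g) (hδ0 : 0 ≤ δ) (hδ1 : δ ≤ 1) (hgδ : K.Minorizing δ g) :
    K.OscDiam ((1 - δ) * ε) (g ∘ h) :=
  fun x hx y hy => hgδ.osc_map (hh x hx y hy) hg hδ0 hδ1

lemma OscDiam.norm_sub_le {ε : ℝ} {g : E → E} (h : K.OscDiam ε g) {x y : E}
    (hx : x ∈ K.states) (hy : y ∈ K.states) :
    ‖K.projAction g x - K.projAction g y‖ ≤ 2 * ε := (h x hx y hy).norm_sub_le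

/-! ### Strict Hennion contractions are minorizing -/

lemma mem_mSet_le_one {x y : E} (hx : x ∈ K.states) (hy : y ∈ K.states) {t : ℝ}
    (ht : K.Pos (x - (t : ℂ) • y)) : t ≤ 1 := by
  have := ht.retr_nonneg
  rw [retr_sub, retr_smul, retr_eq_one hx, retr_eq_one hy] at this
  linarith

lemma le_mQuantity {x y : E} (hx : x ∈ K.states) (hy : y ∈ K.states) {t : ℝ}
    (ht : K.Pos (x - (t : ℂ) • y)) : t ≤ K.mQuantity x y :=
  le_csSup ⟨1, fun _ h => mem_mSet_le_one hx hy h⟩ ht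

lemma mQuantity_nonneg {x y : E} (hx : x ∈ K.states) (hy : y ∈ K.states) :
    0 ≤ K.mQuantity x y :=
  le_mQuantity hx hy (by simpa using hx.1)

/-- The supremum is attained, since the cone is closed and the trace bounds the admissible t by 1.
-/
lemma pos_sub_mQuantity {x y : E} (hx : x ∈ K.states) (hy : y ∈ K.states) :
    K.Pos (x - (K.mQuantity x y : ℂ) • y) := by
  have hc : IsClosed {t : ℝ | K.Pos (x - (t : ℂ) • y)} :=
    isClosed_pos.preimage (f := fun t : ℝ => x - (t : ℂ) • y) (by fun_prop)
  exact hc.csSup_mem ⟨0, by simpa using hx.1⟩ ⟨1, fun _ h => mem_mSet_le_one hx hy h⟩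

lemma mQuantity_le_one {x y : E} (hx : x ∈ K.states) (hy : y ∈ K.states) :
    K.mQuantity x y ≤ 1 := mem_mSet_le_one hx hy (pos_sub_mQuantity hx hy)

/-- Applying g to x ≥ m(x, y) y and normalizing costs a factor τ(g y)/τ(g x), which cancels against
its inverse in the symmetric product. Thus no faithful positive linear map increases Hennion's
distance. -/
lemma mQuantity_mul_le {x y : E} (hx : x ∈ K.states) (hy : y ∈ K.states)
    {g : E → E} (hl : IsLinearMap ℂ g) (hp : K.IsPositiveMap g) (hf : K.IsFaithfulMap g) :
    K.mQuantity x y * K.mQuantity y x ≤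
      K.mQuantity (K.projAction g x) (K.projAction g y) * K.mQuantity (K.projAction g y) (K.projAction g x) := by
  have key : ∀ {x y : E}, x ∈ K.states → y ∈ K.states →
      K.mQuantity x y * (K.retr (g y) / K.retr (g x)) ≤
        K.mQuantity (K.projAction g x) (K.projAction g y) := fun {x y} hx hy => by
    have px := retr_map_state_pos hp hf hx
    have py := retr_map_state_pos hp hf hy
    have hxc : (K.retr (g x) : ℂ) ≠ 0 := by exact_mod_cast px.ne'
    have hyc : (K.retr (g y) : ℂ) ≠ 0 := by exact_mod_cast py.ne'
    refine le_mQuantity (projAction_mem hp hf hx) (projAction_mem hp hf hy) ?_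
    have h := (hp _ (pos_sub_mQuantity hx hy)).smul (inv_nonneg.2 px.le)
    rw [hl.map_sub, hl.map_smul] at h
    convert h using 1
    rw [projAction_eq hp hx.1, projAction_eq hp hy.1]
    push_cast
    match_scalars <;> field_simp
  have px := retr_map_state_pos hp hf hx
  have py := retr_map_state_pos hp hf hy
  have h1 := mul_le_mul (key hx hy) (key hy hx)
    (mul_nonneg (mQuantity_nonneg hy hx) (by positivity))
    (mQuantity_nonneg (projAction_mem hp hf hx) (projAction_mem hp hf hy))
  refine le_of_eq_of_le ?_ h1
  field_simp

lemma hennionDist_mem {x y : E} (hx : x ∈ K.states) (hy : y ∈ K.states) :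
    0 ≤ K.hennionDist x y ∧ K.hennionDist x y ≤ 1 := by
  have h0 := mul_nonneg (mQuantity_nonneg hx hy) (mQuantity_nonneg hy hx)
  have h1 := mul_le_one₀ (mQuantity_le_one hx hy) (mQuantity_nonneg hy hx) (mQuantity_le_one hy hx)
  unfold hennionDist
  exact ⟨div_nonneg (by linarith) (by linarith), (div_le_one (by linarith)).2 (by linarith)⟩

lemma hennionDist_projAction_le {x y : E} (hx : x ∈ K.states)
    (hy : y ∈ K.states) {g : E → E} (hl : IsLinearMap ℂ g) (hp : K.IsPositiveMap g)
    (hf : K.IsFaithfulMap g) :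
    K.hennionDist (K.projAction g x) (K.projAction g y) ≤ K.hennionDist x y := by
  have h0 := mul_nonneg (mQuantity_nonneg hx hy) (mQuantity_nonneg hy hx)
  have h := mQuantity_mul_le hx hy hl hp hf
  unfold hennionDist
  rw [div_le_div_iff₀ (by linarith) (by linarith)]
  nlinarith

/-- Since d ≤ 1, all image distances are at most some c < 1. Solving (1 - p)/(1 + p) ≤ c for p =
m(g·x, g·y) m(g·y, g·x) gives p ≥ (1 - c)/(1 + c), and the second factor is at most 1. -/
lemma exists_minorizing_of_contractionConst_lt_one {g : E → E}
    (hl : IsLinearMap ℂ g) (hp : K.IsPositiveMap g) (hf : K.IsFaithfulMap g)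
    (hc : K.contractionConst g < 1) : ∃ δ : ℝ, 0 < δ ∧ δ ≤ 1 ∧ K.Minorizing δ g := by
  -- A real `sSup` of an unbounded set is 0, so c(g) < 1 says something about the individual ratios
  -- only once they are known to be bounded.
  have hbdd : BddAbove {r : ℝ | ∃ x ∈ K.states, ∃ y ∈ K.states, x ≠ y ∧
      r = K.hennionDist (K.projAction g x) (K.projAction g y) / K.hennionDist x y} := by
    refine ⟨1, ?_⟩
    rintro r ⟨x, hx, y, hy, -, rfl⟩
    exact div_le_one_of_le₀ (hennionDist_projAction_le hx hy hl hp hf) (hennionDist_mem hx hy).1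
  obtain ⟨c, hc0, hc1, hcc⟩ : ∃ c : ℝ, 0 ≤ c ∧ c < 1 ∧ K.contractionConst g ≤ c :=
    ⟨max (K.contractionConst g) 0, le_max_right _ _, max_lt hc one_pos, le_max_left _ _⟩
  have hd : ∀ x ∈ K.states, ∀ y ∈ K.states, x ≠ y →
      K.hennionDist (K.projAction g x) (K.projAction g y) ≤ c := by
    intro x hx y hy hxy
    obtain ⟨d0, d1⟩ := hennionDist_mem hx hy
    have hr := (le_csSup hbdd ⟨x, hx, y, hy, hxy, rfl⟩).trans hcc
    rcases d0.eq_or_lt with h0 | h0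
    -- When d(x, y) = 0 the ratio is a division by zero and carries no information; nonexpansion
    -- suffices.
    · exact (hennionDist_projAction_le hx hy hl hp hf).trans (h0 ▸ hc0)
    · rw [div_le_iff₀ h0] at hr
      nlinarith
  have hδ1 : (1 - c) / (1 + c) ≤ 1 := (div_le_one (by linarith)).2 (by linarith)
  refine ⟨(1 - c) / (1 + c), div_pos (by linarith) (by linarith), hδ1, ?_⟩
  intro x hx y hy
  have hgx := projAction_mem hp hf hx
  have hgy := projAction_mem hp hf hy
  have px := retr_map_state_pos hp hf hx
  have py := retr_map_state_pos hp hf hy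
  have hxc : (K.retr (g x) : ℂ) ≠ 0 := by exact_mod_cast px.ne'
  have hyc : (K.retr (g y) : ℂ) ≠ 0 := by exact_mod_cast py.ne'
  have main : K.Pos (K.projAction g x - (((1 - c) / (1 + c) : ℝ) : ℂ) • K.projAction g y) := by
    by_cases hxy : x = y
    · subst hxy
      convert hgx.1.smul (sub_nonneg.2 hδ1) using 1
      push_cast
      module
    · have h := hd x hx y hy hxy
      have m0 := mQuantity_nonneg hgx hgy
      have m0' := mQuantity_nonneg hgy hgx
      have m1' := mQuantity_le_one hgy hgx
      unfold hennionDist at h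
      rw [div_le_iff₀ (by positivity)] at h
      have hm : (1 - c) / (1 + c) ≤ K.mQuantity (K.projAction g x) (K.projAction g y) := by
        rw [div_le_iff₀ (by linarith)]
        nlinarith [mul_le_of_le_one_right m0 m1']
      convert (pos_sub_mQuantity hgx hgy).add (hgy.1.smul (sub_nonneg.2 hm)) using 1
      push_cast
      module
  convert main.smul (mul_pos px py).le using 1
  rw [projAction_eq hp hx.1, projAction_eq hp hy.1]
  generalize (1 - c) / (1 + c) = δ
  push_cast
  match_scalars <;> field_simp

lemma Minorizing.mono {δ δ' : ℝ} {g : E → E} (h : K.Minorizing δ g) (hp : K.IsPositiveMap g)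
    (hδ : δ' ≤ δ) : K.Minorizing δ' g := by
  intro x hx y hy
  convert (h x hx y hy).add ((hp y hy.1).smul
    (mul_nonneg (sub_nonneg.2 hδ) (hp x hx.1).retr_nonneg)) using 1
  push_cast
  module

/-- The minorization condition may be tested on a dense set of states. -/
lemma minorizing_of_dense {δ : ℝ} {g : E → E} (hg : Continuous g) {Q : Set (E)}
    (hQ : K.states ⊆ closure Q)
    (h : ∀ x ∈ Q, ∀ y ∈ Q, K.Pos ((K.retr (g y) : ℂ) • g x - ((δ * K.retr (g x) : ℝ) : ℂ) • g y)) :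
    K.Minorizing δ g := by
  have hr : Continuous fun x => (K.retr (g x) : ℂ) :=
    Complex.continuous_ofReal.comp (continuous_retr.comp hg)
  have hclosed : IsClosed {p : E × E |
      K.Pos ((K.retr (g p.2) : ℂ) • g p.1 - ((δ * K.retr (g p.1) : ℝ) : ℂ) • g p.2)} := by
    refine isClosed_pos.preimage (f := fun p : E × E =>
      (K.retr (g p.2) : ℂ) • g p.1 - ((δ * K.retr (g p.1) : ℝ) : ℂ) • g p.2) ?_
    simp only [Complex.ofReal_mul]
    have h1 : Continuous fun p : E × E => (K.retr (g p.1) : ℂ) := hr.comp continuous_fst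
    have h2 : Continuous fun p : E × E => (K.retr (g p.2) : ℂ) := hr.comp continuous_snd
    have g1 : Continuous fun p : E × E => g p.1 := hg.comp continuous_fst
    have g2 : Continuous fun p : E × E => g p.2 := hg.comp continuous_snd
    exact (h2.smul g1).sub ((continuous_const.mul h1).smul g2)
  intro x hx y hy
  have hsub : Q ×ˢ Q ⊆ {p : E × E |
      K.Pos ((K.retr (g p.2) : ℂ) • g p.1 - ((δ * K.retr (g p.1) : ℝ) : ℂ) • g p.2)} :=
    fun p hp => h p.1 hp.1 p.2 hp.2
  have := hclosed.closure_subset_iff.2 hsub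
  rw [closure_prod_eq] at this
  exact this (show (x, y) ∈ closure Q ×ˢ closure Q from ⟨hQ hx, hQ hy⟩)

end TracedCone

/-! ### Products of a two-sided sequence of maps -/

section Products

variable {E : Type*}

/-- The composition `f_{m+k} ∘ ⋯ ∘ f_m`. -/
def prodAux (f : ℤ → E → E) (m : ℤ) : ℕ → E → E
  | 0 => f m
  | k + 1 => f (m + (k + 1 : ℕ)) ∘ prodAux f m k

/-- The composition `f_n ∘ ⋯ ∘ f_m` for `m ≤ n`. -/
def prod (f : ℤ → E → E) (n m : ℤ) : E → E := prodAux f m (n - m).toNat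

lemma prodAux_add (f : ℤ → E → E) (m : ℤ) (k l : ℕ) :
    prodAux f m (k + 1 + l) = prodAux f (m + k + 1) l ∘ prodAux f m k := by
  induction l with
  | zero =>
    change f (m + (k + 1 : ℕ)) ∘ _ = f _ ∘ _
    congr 2
    push_cast
    ring
  | succ l ih =>
    change f (m + (k + 1 + l + 1 : ℕ)) ∘ prodAux f m (k + 1 + l) =
      (f (m + k + 1 + (l + 1 : ℕ)) ∘ _) ∘ _
    rw [ih, Function.comp_assoc]
    congr 2
    push_cast
    ring

/-- The strict inequality is needed because there is no empty product: for n < m, `prod f n m` is f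
m. -/
lemma prod_split (f : ℤ → E → E) {n m j : ℤ} (h1 : m ≤ j) (h2 : j < n) :
    prod f n m = prod f n (j + 1) ∘ prod f j m := by
  unfold prod
  have e : (n - m).toNat = (j - m).toNat + 1 + (n - (j + 1)).toNat := by omega
  rw [e, prodAux_add]
  congr 2
  omega

lemma prod_self (f : ℤ → E → E) (n : ℤ) : prod f n n = f n := by
  simp [prod, prodAux]

lemma prodAux_shift (f : ℤ → E → E) (j m : ℤ) (k : ℕ) :
    prodAux (fun i => f (i + j)) m k = prodAux f (m + j) k := by
  induction k with
  | zero => rfl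
  | succ k ih =>
    change f (m + (k + 1 : ℕ) + j) ∘ _ = f (m + j + (k + 1 : ℕ)) ∘ _
    rw [ih]
    congr 2
    ring

lemma prod_shift (f : ℤ → E → E) (j n m : ℤ) :
    prod (fun i => f (i + j)) n m = prod f (n + j) (m + j) := by
  unfold prod
  rw [prodAux_shift]
  congr 2
  ring

end Products

/-! ### Contraction and convergence of backward products -/

namespace TracedCone

variable {E : Type*} [NormedAddCommGroup E] [NormedSpace ℂ E] {K : TracedCone E}

lemma IsFaithfulPositive.prod {f : ℤ → E → E} (hf : ∀ i, K.IsFaithfulPositive (f i)) (n m : ℤ) :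
    K.IsFaithfulPositive (prod f n m) := by
  unfold ErgodicQuantum.prod
  induction (n - m).toNat with
  | zero => exact hf m
  | succ k ih => exact (hf _).comp ih

/-- Extending a product into the past only precomposes it with a map of the state space into itself,
so the image of the state space shrinks as m decreases. -/
lemma projAction_prod_eq {f : ℤ → E → E} (hf : ∀ i, K.IsFaithfulPositive (f i)) {n m m₀ : ℤ}
    (h0 : m₀ ≤ n) (hm : m ≤ m₀) {x : E} (hx : x ∈ K.states) :
    ∃ y ∈ K.states, K.projAction (prod f n m) x = K.projAction (prod f n m₀) y := by
  rcases hm.eq_or_lt with rfl | hm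
  · exact ⟨x, hx, rfl⟩
  · have g1 := IsFaithfulPositive.prod hf (m₀ - 1) m
    refine ⟨_, projAction_mem g1.positive g1.faithful hx, ?_⟩
    rw [prod_split f (show m ≤ m₀ - 1 by omega) (show m₀ - 1 < n by omega), sub_add_cancel,
      projAction_comp (IsFaithfulPositive.prod hf n m₀) g1 hx]

/-- The k + 1 minorizing blocks are disjoint: each lies strictly before the previous one. The most
remote one creates the finite oscillation δ⁻², each of the other k contributes a factor 1 - δ, and
the maps between blocks do no harm. -/
lemma exists_oscDiam_prod {f : ℤ → E → E} (hf : ∀ i, K.IsFaithfulPositive (f i)) {δ : ℝ}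
    (hδ0 : 0 < δ) (hδ1 : δ ≤ 1)
    (hrec : ∀ N : ℤ, ∃ n m : ℤ, m ≤ n ∧ n < N ∧ K.Minorizing δ (prod f n m)) (k : ℕ) (n : ℤ) :
    ∃ m₀ ≤ n, K.OscDiam ((1 - δ) ^ k * δ⁻¹ ^ 2) (prod f n m₀) := by
  induction k generalizing n with
  | zero =>
    obtain ⟨j, m, hmj, hjn, hδ⟩ := hrec n
    refine ⟨m, by omega, ?_⟩
    rw [pow_zero, one_mul, prod_split f hmj hjn]
    exact (hδ.oscDiam (IsFaithfulPositive.prod hf j m) hδ0).comp_left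
      (IsFaithfulPositive.prod hf _ _)
  | succ k ih =>
    obtain ⟨j, m, hmj, hjn, hδ⟩ := hrec n
    obtain ⟨m₀, hm₀, hosc⟩ := ih (m - 1)
    refine ⟨m₀, by omega, ?_⟩
    rw [prod_split f (show m₀ ≤ j by omega) hjn, prod_split f hm₀ (show m - 1 < j by omega),
      sub_add_cancel, pow_succ', mul_assoc]
    exact (hosc.comp_minorizing (IsFaithfulPositive.prod hf j m) hδ0.le hδ1 hδ).comp_left
      (IsFaithfulPositive.prod hf _ _)

lemma exists_norm_projAction_prod_sub_lt {f : ℤ → E → E} (hf : ∀ i, K.IsFaithfulPositive (f i))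
    {δ : ℝ} (hδ0 : 0 < δ) (hδ1 : δ ≤ 1)
    (hrec : ∀ N : ℤ, ∃ n m : ℤ, m ≤ n ∧ n < N ∧ K.Minorizing δ (prod f n m)) (n : ℤ) {ε : ℝ}
    (hε : 0 < ε) :
    ∃ m₀ ≤ n, ∀ m ≤ m₀, ∀ m' ≤ m₀, ∀ x ∈ K.states, ∀ x' ∈ K.states,
      ‖K.projAction (prod f n m) x - K.projAction (prod f n m') x'‖ < ε := by
  have hlim : Tendsto (fun k : ℕ => 2 * ((1 - δ) ^ k * δ⁻¹ ^ 2)) atTop (𝓝 0) := by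
    have := (tendsto_pow_atTop_nhds_zero_of_lt_one (sub_nonneg.2 hδ1)
      (show 1 - δ < 1 by linarith)).mul_const (δ⁻¹ ^ 2)
    simpa using this.const_mul 2
  obtain ⟨k, hk⟩ := (hlim.eventually (gt_mem_nhds hε)).exists
  obtain ⟨m₀, hm₀, hosc⟩ := exists_oscDiam_prod hf hδ0 hδ1 hrec k n
  refine ⟨m₀, hm₀, fun m hm m' hm' x hx x' hx' => ?_⟩
  obtain ⟨y, hy, e⟩ := projAction_prod_eq hf hm₀ hm hx
  obtain ⟨y', hy', e'⟩ := projAction_prod_eq hf hm₀ hm' hx'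
  rw [e, e']
  exact (hosc.norm_sub_le hy hy').trans_lt hk

/-- Backward products with recurrent minorization converge, uniformly in the initial state. -/
lemma exists_tendsto_projAction_prod [CompleteSpace E] {f : ℤ → E → E}
    (hf : ∀ i, K.IsFaithfulPositive (f i)) {δ : ℝ} (hδ0 : 0 < δ) (hδ1 : δ ≤ 1)
    (hrec : ∀ N : ℤ, ∃ n m : ℤ, m ≤ n ∧ n < N ∧ K.Minorizing δ (prod f n m))
    (hne : K.states.Nonempty) (n : ℤ) :
    ∃ z ∈ K.states, ∀ x ∈ K.states,
      Tendsto (fun m => K.projAction (prod f n m) x) atBot (𝓝 z) := by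
  obtain ⟨x₀, hx₀⟩ := hne
  have key := fun {ε : ℝ} hε =>
    exists_norm_projAction_prod_sub_lt hf hδ0 hδ1 hrec n (ε := ε) hε
  have hcauchy : Cauchy (map (fun m => K.projAction (prod f n m) x₀) atBot) := by
    refine Metric.cauchy_iff.2 ⟨inferInstance, fun ε hε => ?_⟩
    obtain ⟨m₀, -, h⟩ := key hε
    refine ⟨_, image_mem_map (Iic_mem_atBot m₀), ?_⟩
    rintro _ ⟨m, hm, rfl⟩ _ ⟨m', hm', rfl⟩
    rw [dist_eq_norm]
    exact h m hm m' hm' x₀ hx₀ x₀ hx₀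
  obtain ⟨z, hz⟩ := CompleteSpace.complete hcauchy
  have hz' : Tendsto (fun m => K.projAction (prod f n m) x₀) atBot (𝓝 z) := hz
  refine ⟨z, isClosed_states.mem_of_tendsto hz' (Eventually.of_forall fun m => ?_), ?_⟩
  · have g := IsFaithfulPositive.prod hf n m
    exact projAction_mem g.positive g.faithful hx₀
  · intro x hx
    refine tendsto_of_tendsto_of_dist hz' (Metric.tendsto_nhds.2 fun ε hε => ?_)
    obtain ⟨m₀, -, h⟩ := key hε
    filter_upwards [Iic_mem_atBot m₀] with m hm
    rw [dist_zero_right, Real.norm_of_nonneg dist_nonneg, dist_eq_norm]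
    exact h m hm m hm x₀ hx₀ x hx

lemma IsFaithfulPositive.continuousAt_projAction {g : E → E} (hg : K.IsFaithfulPositive g) {x : E}
    (hx : x ∈ K.states) : ContinuousAt (K.projAction g) x := by
  have hc := hg.bounded.continuous
  have h0 : K.trace (g x) ≠ 0 := fun h => by
    have := retr_map_state_pos hg.positive hg.faithful hx
    simp [retr, h] at this
  exact ((K.trace.continuous.comp hc).continuousAt.inv₀ h0).smul hc.continuousAt

end TracedCone

/-! ### Measurability and recurrence -/

section Random

variable {Ω : Type*} [MeasurableSpace Ω] {P : Measure Ω}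

lemma iter_add (T : Ω ≃ᵐ Ω) (a b : ℤ) (ω : Ω) : iter T (a + b) ω = iter T a (iter T b ω) := by
  simp [iter, zpow_add]

lemma iter_one (T : Ω ≃ᵐ Ω) (ω : Ω) : iter T 1 ω = T ω := by simp [iter]

lemma iter_neg_one (T : Ω ≃ᵐ Ω) (ω : Ω) : iter T (-1) ω = T.symm ω := by
  simp only [iter, zpow_neg_one]
  rfl

lemma iter_neg_nat (T : Ω ≃ᵐ Ω) (k : ℕ) (ω : Ω) : iter T (-(k : ℤ)) ω = T.symm^[k] ω := by
  induction k with
  | zero => simp [iter]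
  | succ k ih =>
    rw [Function.iterate_succ_apply', ← ih, ← iter_neg_one, ← iter_add]
    congr 1
    push_cast
    ring

lemma measurePreserving_iter {T : Ω ≃ᵐ Ω} (hT : MeasurePreserving T P P) (n : ℤ) :
    MeasurePreserving (iter T n) P P := by
  induction n using Int.induction_on with
  | zero =>
    have e : iter T 0 = id := by
      ext ω
      simp [iter]
    rw [e]
    exact MeasurePreserving.id P
  | succ n ih =>
    have e : iter T (n + 1) = T ∘ iter T n := by
      ext ω
      rw [add_comm, iter_add, iter_one, Function.comp_apply]
    rw [e]
    exact hT.comp ih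
  | pred n ih =>
    have e : iter T (-n - 1) = T.symm ∘ iter T (-n) := by
      ext ω
      rw [sub_eq_add_neg, add_comm, iter_add, iter_neg_one, Function.comp_apply]
    rw [e]
    exact (hT.symm T).comp ih

/-- Almost every orbit of an ergodic map visits a set of positive measure infinitely often. -/
lemma ae_frequently_iterate_mem [IsFiniteMeasure P] {S : Ω → Ω} (hS : Ergodic S P) {A : Set Ω}
    (hA : NullMeasurableSet A P) (h0 : P A ≠ 0) : ∀ᵐ ω ∂P, ∃ᶠ k in atTop, S^[k] ω ∈ A := by
  have hU : NullMeasurableSet (⋃ k : ℕ, S^[k] ⁻¹' A) P :=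
    NullMeasurableSet.iUnion fun k =>
      hA.preimage (hS.toMeasurePreserving.iterate k).quasiMeasurePreserving
  have hsub : S ⁻¹' (⋃ k : ℕ, S^[k] ⁻¹' A) ⊆ ⋃ k : ℕ, S^[k] ⁻¹' A := by
    intro ω hω
    obtain ⟨k, hk⟩ := Set.mem_iUnion.1 hω
    exact Set.mem_iUnion.2 ⟨k + 1, hk⟩
  have hfull : ∀ᵐ ω ∂P, ω ∈ ⋃ k : ℕ, S^[k] ⁻¹' A := by
    rcases hS.ae_empty_or_univ_of_preimage_ae_le hU hsub.eventuallyLE with h | h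
    · exfalso
      refine h0 (measure_mono_null ?_ (ae_eq_empty.1 h))
      exact Set.subset_iUnion_of_subset 0 subset_rfl
    · filter_upwards [h] with ω hω
      exact hω.mpr trivial
  -- Ergodicity gives one visit; conservativity (Poincaré recurrence) upgrades it to infinitely
  -- many.
  filter_upwards [hfull, hS.toMeasurePreserving.conservative
    |>.ae_forall_image_mem_imp_frequently_image_mem hA] with ω h1 h2
  obtain ⟨k, hk⟩ := Set.mem_iUnion.1 h1
  exact h2 k hk

/-- A Carathéodory-type composition preserves strong measurability. -/
lemma aestronglyMeasurable_apply {E F : Type*} [TopologicalSpace E] [NormedAddCommGroup F]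
    {γ : Ω → E → F} (hm : ∀ x, AEStronglyMeasurable (fun ω => γ ω x) P)
    (hc : ∀ᵐ ω ∂P, Continuous (γ ω)) {f : Ω → E} (hf : AEStronglyMeasurable f P) :
    AEStronglyMeasurable (fun ω => γ ω (f ω)) P := by
  have simple : ∀ s : SimpleFunc Ω E, AEStronglyMeasurable (fun ω => γ ω (s ω)) P := by
    intro s
    classical
    have e : (fun ω => γ ω (s ω)) =
        fun ω => ∑ x ∈ s.range, (s ⁻¹' {x}).indicator (fun ω => γ ω x) ω := by
      ext ω
      rw [Finset.sum_eq_single_of_mem (s ω) (s.mem_range_self ω)]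
      · simp
      · intro x _ hx
        exact Set.indicator_of_notMem (fun h => hx h.symm) _
    rw [e]
    exact Finset.aestronglyMeasurable_fun_sum _ fun x _ =>
      (hm x).indicator (s.measurableSet_fiber x)
  have h : AEStronglyMeasurable (fun ω => γ ω (hf.mk f ω)) P := by
    refine aestronglyMeasurable_of_tendsto_ae atTop
      (fun n => simple (hf.stronglyMeasurable_mk.approx n)) ?_
    filter_upwards [hc] with ω hω
    exact (hω.tendsto _).comp (hf.stronglyMeasurable_mk.tendsto_approx ω)
  refine h.congr ?_
  filter_upwards [hf.ae_eq_mk] with ω hω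
  rw [hω]

variable {E : Type*} [NormedAddCommGroup E] [NormedSpace ℂ E] {K : TracedCone E}

/-- The two-sided sequence of maps seen along the orbit of `ω`. -/
def orbitMaps (T : Ω ≃ᵐ Ω) (γ : Ω → E → E) (ω : Ω) (i : ℤ) : E → E := γ (iter T i ω)

omit [NormedSpace ℂ E] in
lemma aestronglyMeasurable_prod {T : Ω ≃ᵐ Ω} (hT : MeasurePreserving T P P) {γ : Ω → E → E}
    (hm : ∀ x, AEStronglyMeasurable (fun ω => γ ω x) P) (hc : ∀ᵐ ω ∂P, Continuous (γ ω))
    (n m : ℤ) (x : E) : AEStronglyMeasurable (fun ω => prod (orbitMaps T γ ω) n m x) P := by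
  have hm' : ∀ i x, AEStronglyMeasurable (fun ω => orbitMaps T γ ω i x) P := fun i x =>
    (hm x).comp_measurePreserving (measurePreserving_iter hT i)
  have hc' : ∀ i, ∀ᵐ ω ∂P, Continuous (orbitMaps T γ ω i) := fun i =>
    (measurePreserving_iter hT i).quasiMeasurePreserving.ae hc
  unfold prod
  induction (n - m).toNat with
  | zero => exact hm' m x
  | succ k ih => exact aestronglyMeasurable_apply (hm' _) (hc' _) ih

omit [NormedSpace ℂ E] [NormedAddCommGroup E] in
lemma orbitMaps_iter (T : Ω ≃ᵐ Ω) (γ : Ω → E → E) (ω : Ω) (j : ℤ) :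
    orbitMaps T γ (iter T j ω) = fun i => orbitMaps T γ ω (i + j) := by
  ext i x
  simp only [orbitMaps, iter_add]

/-- If some product minorizes with positive probability then almost surely, with one constant,
arbitrarily remote products do. -/
lemma exists_ae_recurrent_minorizing [TopologicalSpace.SeparableSpace E] [IsFiniteMeasure P]
    {T : Ω ≃ᵐ Ω} (hT : Ergodic T P) {γ : Ω → E → E}
    (hm : ∀ x, AEStronglyMeasurable (fun ω => γ ω x) P)
    (hγ : ∀ᵐ ω ∂P, ∀ i, K.IsFaithfulPositive (orbitMaps T γ ω i))
    (hpos : 0 < P {ω | ∃ n m : ℤ, m ≤ n ∧ ∃ δ : ℝ, 0 < δ ∧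
      K.Minorizing δ (prod (orbitMaps T γ ω) n m) ∧ K.IsPositiveMap (prod (orbitMaps T γ ω) n m)}) :
    ∃ δ : ℝ, 0 < δ ∧ δ ≤ 1 ∧ ∀ᵐ ω ∂P, ∀ N : ℤ, ∃ n m : ℤ, m ≤ n ∧ n < N ∧
      K.Minorizing δ (prod (orbitMaps T γ ω) n m) := by
  obtain ⟨Q, hQs, hQc, hQd⟩ :=
    (TopologicalSpace.IsSeparable.of_separableSpace K.states).exists_countable_dense_subset
  -- Minorization with constant 1/(l + 1), tested only on a countable dense set of states, so that
  -- the event is null measurable.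
  obtain ⟨A, hA⟩ : ∃ A : ℤ → ℤ → ℕ → Set Ω, A = fun n m (l : ℕ) => {ω | ∀ x ∈ Q, ∀ y ∈ Q,
      K.Pos ((K.retr (prod (orbitMaps T γ ω) n m y) : ℂ) • prod (orbitMaps T γ ω) n m x -
        ((1 / ((l : ℝ) + 1) * K.retr (prod (orbitMaps T γ ω) n m x) : ℝ) : ℂ) •
          prod (orbitMaps T γ ω) n m y)} := ⟨_, rfl⟩
  have hc : ∀ᵐ ω ∂P, Continuous (γ ω) := by
    filter_upwards [hγ] with ω h
    have := (h 0).bounded.continuous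
    simpa [orbitMaps, iter] using this
  have hmeas : ∀ n m l, NullMeasurableSet (A n m l) P := by
    intro n m l
    have hx := aestronglyMeasurable_prod hT.toMeasurePreserving hm hc n m
    have hr : ∀ x, AEStronglyMeasurable
        (fun ω => (K.retr (prod (orbitMaps T γ ω) n m x) : ℂ)) P := fun x =>
      (Complex.continuous_ofReal.comp TracedCone.continuous_retr).comp_aestronglyMeasurable (hx x)
    simp only [hA, Set.ofPred_forall]
    refine NullMeasurableSet.biInter hQc fun x _ => NullMeasurableSet.biInter hQc fun y _ => ?_
    borelize E
    have hF : AEStronglyMeasurable (fun ω =>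
        (K.retr (prod (orbitMaps T γ ω) n m y) : ℂ) • prod (orbitMaps T γ ω) n m x -
        ((1 / ((l : ℝ) + 1) * K.retr (prod (orbitMaps T γ ω) n m x) : ℝ) : ℂ) •
          prod (orbitMaps T γ ω) n m y) P := by
      simp only [Complex.ofReal_mul]
      exact ((hr y).smul (hx x)).sub (((hr x).const_mul _).smul (hx y))
    exact hF.aemeasurable.nullMeasurableSet_preimage
      (TracedCone.isClosed_pos (K := K)).measurableSet
  -- The constant δ may depend on ω; a countable union over blocks and over l isolates one choice of
  -- positive measure.
  obtain ⟨n, m, l, hmn, hP⟩ : ∃ n m : ℤ, ∃ l : ℕ, m ≤ n ∧ P (A n m l) ≠ 0 := by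
    by_contra! hcon
    refine hpos.ne' (measure_mono_null (t := ⋃ n : ℤ, ⋃ m : ℤ, ⋃ _ : m ≤ n, ⋃ l : ℕ, A n m l) ?_ ?_)
    · rintro ω ⟨n, m, hmn, δ, hδ, hmin, hp⟩
      obtain ⟨l, hl⟩ := exists_nat_one_div_lt hδ
      simp only [Set.mem_iUnion]
      refine ⟨n, m, hmn, l, ?_⟩
      rw [hA]
      exact fun x hx y hy => hmin.mono hp hl.le x (hQs hx) y (hQs hy)
    · simp only [measure_iUnion_null_iff]
      exact fun n m hmn l => hcon n m l hmn
  refine ⟨1 / ((l : ℝ) + 1), by positivity, (div_le_one (by positivity)).2 (by simp), ?_⟩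
  -- Recurrence is applied to the inverse of T: a visit of T^{-k} ω to the event makes the block
  -- from m - k to n - k minorizing for ω, and k ≥ n - N + 1 places it before N.
  filter_upwards [hγ, ae_frequently_iterate_mem hT.symm (hmeas n m l) hP] with ω hω hfreq N
  obtain ⟨k, hk, hkA⟩ := frequently_atTop.1 hfreq (n - N + 1).toNat
  rw [← iter_neg_nat, hA] at hkA
  refine ⟨n + -k, m + -k, by omega, by omega, ?_⟩
  refine TracedCone.minorizing_of_dense
    (TracedCone.IsFaithfulPositive.prod hω _ _).bounded.continuous hQd fun x hx y hy => ?_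
  have := hkA x hx y hy
  rwa [orbitMaps_iter, prod_shift] at this

/-! ### The stationary trajectory -/

/-- Random products of faithful positive operators which minorize with positive probability admit
a stationary trajectory of states attracting all initial states from the remote past. -/
theorem exists_stationary_trajectory [CompleteSpace E] [TopologicalSpace.SeparableSpace E]
    [IsFiniteMeasure P] (hne : K.states.Nonempty) {T : Ω ≃ᵐ Ω} (hT : Ergodic T P) {γ : Ω → E → E}
    (hm : ∀ x, AEStronglyMeasurable (fun ω => γ ω x) P)
    (hγ : ∀ᵐ ω ∂P, K.IsFaithfulPositive (γ ω))
    (hpos : 0 < P {ω | ∃ n m : ℤ, m ≤ n ∧ ∃ δ : ℝ, 0 < δ ∧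
      K.Minorizing δ (prod (orbitMaps T γ ω) n m) ∧ K.IsPositiveMap (prod (orbitMaps T γ ω) n m)}) :
    ∃ X : ℤ → Ω → E,
      (∀ n ω, X n ω ∈ K.states) ∧
      (∀ n, AEStronglyMeasurable (X n) P) ∧
      (∀ᵐ ω ∂P, ∀ n : ℤ, K.projAction (γ (iter T (n + 1) ω)) (X n ω) = X (n + 1) ω ∧
        X n (T ω) = X (n + 1) ω ∧ X n (T.symm ω) = X (n - 1) ω) ∧
      ∀ᵐ ω ∂P, ∀ x ∈ K.states, ∀ n : ℤ,
        Tendsto (fun m : ℤ => K.projAction (prod (orbitMaps T γ ω) n m) x) atBot (𝓝 (X n ω)) := by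
  have hall : ∀ᵐ ω ∂P, ∀ i, K.IsFaithfulPositive (orbitMaps T γ ω i) :=
    ae_all_iff.2 fun i =>
      (measurePreserving_iter hT.toMeasurePreserving i).quasiMeasurePreserving.ae hγ
  obtain ⟨δ, hδ0, hδ1, hrec⟩ := exists_ae_recurrent_minorizing hT hm hall hpos
  have hlim : ∀ᵐ ω ∂P, ∀ n : ℤ, ∃ z ∈ K.states, ∀ x ∈ K.states,
      Tendsto (fun m => K.projAction (prod (orbitMaps T γ ω) n m) x) atBot (𝓝 z) := by
    filter_upwards [hall, hrec] with ω h1 h2 n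
    exact TracedCone.exists_tendsto_projAction_prod h1 hδ0 hδ1 h2 hne n
  obtain ⟨x₀, hx₀⟩ := hne
  -- The value x₀ is the default where the limit fails to exist, so that X takes values in the
  -- states everywhere.
  have hchoice : ∀ n ω, ∃ z ∈ K.states, (∃ z ∈ K.states, ∀ x ∈ K.states,
      Tendsto (fun m => K.projAction (prod (orbitMaps T γ ω) n m) x) atBot (𝓝 z)) →
      ∀ x ∈ K.states,
        Tendsto (fun m => K.projAction (prod (orbitMaps T γ ω) n m) x) atBot (𝓝 z) := by
    intro n ω
    by_cases h : ∃ z ∈ K.states, ∀ x ∈ K.states,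
      Tendsto (fun m => K.projAction (prod (orbitMaps T γ ω) n m) x) atBot (𝓝 z)
    · obtain ⟨z, hz, hzx⟩ := h
      exact ⟨z, hz, fun _ => hzx⟩
    · exact ⟨x₀, hx₀, fun h' => absurd h' h⟩
  choose X hXs hX using hchoice
  have hXlim : ∀ᵐ ω ∂P, ∀ n : ℤ, ∀ x ∈ K.states,
      Tendsto (fun m => K.projAction (prod (orbitMaps T γ ω) n m) x) atBot (𝓝 (X n ω)) := by
    filter_upwards [hlim] with ω h n using hX n ω (h n)
  have hshift : ∀ j : ℤ, ∀ᵐ ω ∂P, ∀ n, X n (iter T j ω) = X (n + j) ω := by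
    intro j
    filter_upwards [hXlim, (measurePreserving_iter hT.toMeasurePreserving
      j).quasiMeasurePreserving.ae hXlim] with ω h1 h2 n
    -- The backward products along the shifted orbit are those of the original orbit with both
    -- indices translated by j.
    refine tendsto_nhds_unique (h2 n x₀ hx₀) ?_
    simp only [orbitMaps_iter, prod_shift]
    exact (h1 (n + j) x₀ hx₀).comp (tendsto_atBot_add_const_right _ j tendsto_id)
  refine ⟨X, hXs, fun n => ?_, ?_, ?_⟩
  · have hc : ∀ᵐ ω ∂P, Continuous (γ ω) := by
      filter_upwards [hγ] with ω h using h.bounded.continuous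
    refine aestronglyMeasurable_of_tendsto_ae atBot
      (f := fun m ω => K.projAction (prod (orbitMaps T γ ω) n m) x₀) (fun m => ?_) ?_
    · have h1 := aestronglyMeasurable_prod hT.toMeasurePreserving hm hc n m x₀
      have h2 := (K.trace.continuous.comp_aestronglyMeasurable h1).aemeasurable.inv
      exact h2.aestronglyMeasurable.smul h1
    · filter_upwards [hXlim] with ω h using h n x₀ hx₀
  · filter_upwards [hall, hXlim, hshift 1, hshift (-1)] with ω h1 h2 h3 h4 n
    refine ⟨?_, by rw [← iter_one, h3], by rw [← iter_neg_one, h4, sub_eq_add_neg]⟩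
    have hg : K.IsFaithfulPositive (γ (iter T (n + 1) ω)) := h1 (n + 1)
    refine tendsto_nhds_unique
      ((hg.continuousAt_projAction (hXs n ω)).tendsto.comp (h2 n x₀ hx₀))
      ((h2 (n + 1) x₀ hx₀).congr' ?_)
    filter_upwards [Iic_mem_atBot n] with m hm
    rw [prod_split _ hm (lt_add_one n), prod_self, TracedCone.projAction_comp (h1 _)
      (TracedCone.IsFaithfulPositive.prod h1 n m) hx₀]
    rfl
  · filter_upwards [hXlim] with ω h x hx n using h n x hx

end Random

/-! ### The positive cone of `L¹(M, τ)` -/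

section Predual

variable {M : Type*} [CStarAlgebra M] [PartialOrder M] [StarOrderedRing M] {τ : StrongDual ℂ M}

/-- A positive functional is bounded by its value at `1`. -/
lemma norm_le_re_apply_one {φ : StrongDual ℂ M} (hφ : ∀ a : M, 0 ≤ a → 0 ≤ φ a) :
    ‖φ‖ ≤ (φ 1).re := by
  have h1 : 0 ≤ (φ 1).re := (Complex.le_def.1 (hφ 1 zero_le_one)).1
  refine ContinuousLinearMap.opNorm_le_bound φ h1 fun b => ?_
  have h := norm_star_mul_sq_le hφ 1 b
  rw [star_one, one_mul, one_mul] at h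
  have h2 : (φ (star b * b)).re ≤ ‖b‖ ^ 2 * (φ 1).re := by
    have h3 : star b * b ≤ algebraMap ℝ M (‖b‖ ^ 2) := by
      have := IsSelfAdjoint.le_algebraMap_norm_self (IsSelfAdjoint.star_mul_self b)
      rwa [CStarRing.norm_star_mul_self, ← sq] at this
    have h4 : algebraMap ℝ M (‖b‖ ^ 2) = ((‖b‖ ^ 2 : ℝ) : ℂ) • (1 : M) := by
      rw [Algebra.algebraMap_eq_smul_one, Complex.coe_smul]
    have h5 := (Complex.le_def.1 (hφ _ (sub_nonneg.2 h3))).1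
    rw [h4, map_sub, map_smul, Complex.sub_re, smul_eq_mul, Complex.re_ofReal_mul] at h5
    simpa using h5
  calc ‖φ b‖ ≤ √(φ 1).re * √(‖b‖ ^ 2 * (φ 1).re) :=
        h.trans (mul_le_mul_of_nonneg_left (Real.sqrt_le_sqrt h2) (Real.sqrt_nonneg _))
    _ = (√(φ 1).re * √(φ 1).re) * ‖b‖ := by
      rw [Real.sqrt_mul (by positivity), Real.sqrt_sq (norm_nonneg b)]
      ring
    _ = (φ 1).re * ‖b‖ := by rw [Real.mul_self_sqrt h1]

variable (τ) in
/-- The trace and the positive cone of `L¹(M, τ)`. -/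
noncomputable def predualCone : TracedCone (L1 τ) where
  carrier := {x | Pos x}
  trace := (ContinuousLinearMap.apply ℂ ℂ (1 : M)).comp (L1 τ).subtypeL
  isClosed := by
    have e : {x : L1 τ | Pos x} =
        ⋂ a : M, ⋂ _ : 0 ≤ a, {x : L1 τ | 0 ≤ (x : StrongDual ℂ M) a} := by
      ext x
      simp [Pos]
    rw [e]
    refine isClosed_iInter fun a => isClosed_iInter fun _ => ?_
    have : Continuous fun f : StrongDual ℂ M => f a := by fun_prop
    exact isClosed_le continuous_const (this.comp continuous_subtype_val)
  zero_mem := fun a _ => le_of_eq rfl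
  add_mem := fun _ hx _ hy a ha => add_nonneg (hx a ha) (hy a ha)
  smul_mem := fun x hx t ht a ha => by
    have ht' : (0 : ℂ) ≤ t := by exact_mod_cast ht
    exact mul_nonneg ht' (hx a ha)
  trace_im := fun x hx => (Complex.le_def.1 (hx 1 zero_le_one)).2.symm
  norm_le_trace := fun x hx => norm_le_re_apply_one hx

/-- The trace itself, as the functional of 1, is a normal state. -/
lemma IsFaithfulNormalTrace.nonempty_states (hτ : IsFaithfulNormalTrace τ) :
    (predualCone τ).states.Nonempty :=
  ⟨⟨τ, Submodule.le_topologicalClosure _ ⟨1, by ext; simp [traceFunctional]⟩⟩,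
    fun a ha => hτ.nonneg a ha, hτ.map_one⟩

omit [PartialOrder M] [StarOrderedRing M] in
lemma process_eq_prod {Ω : Type*} [MeasurableSpace Ω] (T : Ω ≃ᵐ Ω) (γ : Ω → L1 τ → L1 τ)
    (n m : ℤ) (ω : Ω) : process T γ n m ω = prod (orbitMaps T γ ω) n m := by
  unfold process prod
  induction (n - m).toNat with
  | zero => rfl
  | succ k ih =>
    change _ ∘ _ = _ ∘ _
    rw [ih]
    rfl

/-- The abstract notions for `predualCone τ` unfold to the concrete ones on `L1 τ`, so the result on
cones applies verbatim. -/
lemma IsStrictHennionContraction.exists_minorizing {g : L1 τ → L1 τ}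
    (hg : IsStrictHennionContraction g) :
    ∃ δ : ℝ, 0 < δ ∧ (predualCone τ).Minorizing δ g ∧ (predualCone τ).IsPositiveMap g := by
  obtain ⟨δ, h0, -, h⟩ := TracedCone.exists_minorizing_of_contractionConst_lt_one
    (K := predualCone τ) hg.linear hg.positive hg.faithful hg.lt_one
  exact ⟨δ, h0, h, hg.positive⟩

end Predual

end ErgodicQuantum

theorem theoremA {M : Type*} [CStarAlgebra M] [WStarAlgebra M] [PartialOrder M] [StarOrderedRing M]
    (τ : StrongDual ℂ M) (hτ : ErgodicQuantum.IsFaithfulNormalTrace τ)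
    [TopologicalSpace.SeparableSpace (ErgodicQuantum.L1 τ)]
    {Ω : Type*} [MeasurableSpace Ω] (P : Measure Ω) [IsProbabilityMeasure P]
    (T : Ω ≃ᵐ Ω) (hT : Ergodic T P)
    (γ : Ω → ErgodicQuantum.L1 τ → ErgodicQuantum.L1 τ)
    (hγ : ErgodicQuantum.IsBddPosFaithfulRLO P γ)
    (hSHC : 0 < P {ω | ∃ n m : ℤ, m ≤ n ∧
      ErgodicQuantum.IsStrictHennionContraction (ErgodicQuantum.process T γ n m ω)}) :
    ∃ X : ℤ → Ω → ErgodicQuantum.L1 τ,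
      (∀ n ω, X n ω ∈ ErgodicQuantum.normalStates τ) ∧
      (∀ n, AEStronglyMeasurable (X n) P) ∧
      (∀ᵐ ω ∂P, ∀ n : ℤ,
        ErgodicQuantum.projAction (γ (ErgodicQuantum.iter T (n + 1) ω)) (X n ω) = X (n + 1) ω ∧
        X n (T ω) = X (n + 1) ω ∧ X n (T.symm ω) = X (n - 1) ω) ∧
      ∀ x ∈ ErgodicQuantum.normalStates τ, ∀ᵐ ω ∂P, ∀ n : ℤ,
        Tendsto
          (fun m : ℤ => ‖ErgodicQuantum.projAction (ErgodicQuantum.process T γ n m ω) x - X n ω‖)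
          atBot (𝓝 0) := by
  have hpos : 0 < P {ω | ∃ n m : ℤ, m ≤ n ∧ ∃ δ : ℝ, 0 < δ ∧
      (ErgodicQuantum.predualCone τ).Minorizing δ
        (ErgodicQuantum.prod (ErgodicQuantum.orbitMaps T γ ω) n m) ∧
      (ErgodicQuantum.predualCone τ).IsPositiveMap
        (ErgodicQuantum.prod (ErgodicQuantum.orbitMaps T γ ω) n m)} := by
    refine hSHC.trans_le (measure_mono ?_)
    rintro ω ⟨n, m, hmn, h⟩
    rw [ErgodicQuantum.process_eq_prod] at h
    exact ⟨n, m, hmn, h.exists_minorizing⟩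
  have hfp : ∀ᵐ ω ∂P, (ErgodicQuantum.predualCone τ).IsFaithfulPositive (γ ω) := by
    filter_upwards [hγ.bounded, hγ.positive, hγ.faithful] with ω h1 h2 h3 using ⟨h1, h2, h3⟩
  have : CompleteSpace (ErgodicQuantum.L1 τ) :=
    (Submodule.isClosed_topologicalClosure _).completeSpace_coe
  obtain ⟨X, h1, h2, h3, h4⟩ := ErgodicQuantum.exists_stationary_trajectory
    (K := ErgodicQuantum.predualCone τ) hτ.nonempty_states hT hγ.measurable hfp hpos
  refine ⟨X, h1, h2, h3, fun x hx => ?_⟩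
  filter_upwards [h4] with ω h n
  simp only [ErgodicQuantum.process_eq_prod]
  exact tendsto_iff_norm_sub_tendsto_zero.1 (h x hx n)
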